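/- Let $d\ge 1$, let $A\in\mathbb R^{d\times d}$, and let $r=r_1\ge r_2\ge\dots\ge r_d\ge 0$ be integers with $n:=\sum_{i=1}^d r_i\ge d$. Let $\mathcal L_{(A;\underline r)}$ be the linear space of all matrices $P=\begin{bmatrix}P_1\\ \vdots\\ P_d\end{bmatrix}\in\mathbb R^{n\times d}$ such that $P_1\in\mathbb R^{r\times d}$ and, for every $i$, the block $P_i\in\mathbb R^{r_i\times d}$ consists of the first $r_i$ rows of $P_1A^{i-1}$ (blocks with $r_i=0$ are void), and let $$\mathcal P_{(A;\underline r)}=\{P\in\mathcal L_{(A;\underline r)} : \operatorname{rank}P=d\},$$ an open subset of $\mathcal L_{(A;\underline r)}$, with the corresponding smooth structure. Let $C_A=\{X\in\mathbb R^{d\times d}: XA=AX\}$ and let $\widetilde C_A=C_A\cap GL(d,\mathbb R)$, a group which is an open subset of the vector space $C_A$, so that $\dim\widetilde C_A=\dim C_A$. Then the action $(X,P)\mapsto PX$ of $\widetilde C_A$ on $\mathcal P_{(A;\underline r)}$ by right multiplication is free and proper. Moreover, the orbit space $\mathcal P_{(A;\underline r)}/\widetilde C_A$, with the quotient topology, is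 Hausdorff and second countable and has the structure of a smooth manifold for which the natural projection $\pi:\mathcal P_{(A;\underline r)}\to\mathcal P_{(A;\underline r)}/\widetilde C_A$ is a smooth submersion; if $\mathcal P_{(A;\underline r)}\ne\emptyset$, the dimension of this manifold is $rd-\dim\widetilde C_A$. -/

import Mathlib

open scoped Manifold ContDiff Topology MatrixGroups

namespace TruncObs

/-- The centralizer `C_A = {X : X A = A X}` of `A` in the algebra of all real `d × d` matrices. -/
def centralizer {d : ℕ} (A : Matrix (Fin d) (Fin d) ℝ) :
    Subalgebra ℝ (Matrix (Fin d) (Fin d) ℝ) :=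
  Subalgebra.centralizer ℝ {A}

theorem mem_centralizer_iff {d : ℕ} {A X : Matrix (Fin d) (Fin d) ℝ} :
    X ∈ centralizer A ↔ X * A = A * X := by
  simp [centralizer, Subalgebra.mem_centralizer_iff, eq_comm]

/-- The invertible centralizer `C̃_A = {X ∈ GL(d) : X ∈ C_A}`, a subgroup of `GL(d, ℝ)`. -/
def invCentralizer {d : ℕ} (A : Matrix (Fin d) (Fin d) ℝ) : Subgroup (GL (Fin d) ℝ) where
  carrier := {X | (X : Matrix (Fin d) (Fin d) ℝ) ∈ centralizer A}
  one_mem' := by simp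
  mul_mem' := by
    intro X Y hX hY
    simpa using (centralizer A).mul_mem hX hY
  inv_mem' := by
    intro X hX
    have h : Commute (X : Matrix (Fin d) (Fin d) ℝ) A := mem_centralizer_iff.1 hX
    exact mem_centralizer_iff.2 h.units_inv_left

/-- The inclusion of `C̃_A` into the vector space `C_A`. -/
def toCentralizer {d : ℕ} (A : Matrix (Fin d) (Fin d) ℝ) (X : invCentralizer A) :
    centralizer A :=
  ⟨((X : GL (Fin d) ℝ) : Matrix (Fin d) (Fin d) ℝ), X.2⟩

/-- `C̃_A` is homeomorphic, through the inclusion, to an open subset of the vector space `C_A`. -/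
theorem isOpenEmbedding_toCentralizer {d : ℕ} (A : Matrix (Fin d) (Fin d) ℝ) :
    Topology.IsOpenEmbedding (toCentralizer A) := by
  have hval : Topology.IsEmbedding (Units.val : GL (Fin d) ℝ → Matrix (Fin d) (Fin d) ℝ) := by
    refine Units.isEmbedding_val_mk' (f := fun M => M⁻¹) ?_ ?_
    · intro M hM
      have hd : M.det ≠ 0 := ((Matrix.isUnit_iff_isUnit_det M).1 hM).ne_zero
      refine ContinuousAt.continuousWithinAt ?_
      have h1 : ContinuousAt (fun N : Matrix (Fin d) (Fin d) ℝ => N.det⁻¹ • N.adjugate) M :=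
        (Continuous.continuousAt (continuous_id.matrix_det)).inv₀ hd |>.smul
          (continuous_id.matrix_adjugate).continuousAt
      have h2 : (fun N : Matrix (Fin d) (Fin d) ℝ => N⁻¹) = fun N => N.det⁻¹ • N.adjugate := by
        funext N
        rw [Matrix.inv_def, Ring.inverse_eq_inv']
      rw [h2]
      exact h1
    · intro u
      exact (Matrix.coe_units_inv u).symm
  refine ⟨?_, ?_⟩
  · refine Topology.IsEmbedding.of_comp ?_ continuous_subtype_val ?_
    · exact (hval.continuous.comp continuous_subtype_val).subtype_mk _
    · exact hval.comp Topology.IsEmbedding.subtypeVal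
  · have h : Set.range (toCentralizer A)
        = {X : centralizer A | (X : Matrix (Fin d) (Fin d) ℝ).det ≠ 0} := by
      ext X
      constructor
      · rintro ⟨Y, rfl⟩
        exact ((Matrix.isUnit_iff_isUnit_det _).1 (Y : GL (Fin d) ℝ).isUnit).ne_zero
      · intro hX
        exact ⟨⟨Matrix.GeneralLinearGroup.mkOfDetNeZero X.1 hX, X.2⟩, Subtype.ext rfl⟩
    rw [h]
    exact isOpen_ne_fun (continuous_subtype_val.matrix_det) continuous_const

/-- `C̃_A` is a manifold modelled on the vector space `C_A`, of which it is an open subset. -/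
noncomputable instance instChartedSpaceInvCentralizer {d : ℕ} (A : Matrix (Fin d) (Fin d) ℝ) :
    ChartedSpace (centralizer A) (invCentralizer A) :=
  (isOpenEmbedding_toCentralizer A).singletonChartedSpace

/-- The dimension of the manifold `C̃_A`, i.e. that of its model vector space `C_A`. -/
noncomputable def dimInvCentralizer {d : ℕ} (A : Matrix (Fin d) (Fin d) ℝ) : ℕ :=
  Module.finrank ℝ (centralizer A)

section

variable {d : ℕ} [NeZero d] (A : Matrix (Fin d) (Fin d) ℝ) (r : Fin d → ℕ) (hr : Antitone r)

/-- The linear space of all `n × d` matrices, `n = r_1 + ⋯ + r_d`, of the form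
`P = [P_1; P_2; …; P_d]` where `P_1` is `r_1 × d` and `P_i` consists of the first `r_i` rows
of `P_1 A^(i-1)`. The rows of `P` are indexed by pairs (block `i`, row `l` of block `i`), and
blocks are numbered from `0`; blocks with `r_i = 0` are void. The `n × d` matrix `P` is written
as the function `(row, column) ↦ entry`, so that the linear space has a topology and a norm (the
entrywise ones). -/
def truncObsSpace : Submodule ℝ ((Σ i : Fin d, Fin (r i)) → Fin d → ℝ) where
  carrier := {P | ∃ P₁ : Matrix (Fin (r 0)) (Fin d) ℝ, ∀ (i : Fin d) (l : Fin (r i)),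
    P ⟨i, l⟩ = (P₁ * A ^ (i : ℕ)) (Fin.castLE (hr (Fin.zero_le i)) l)}
  zero_mem' := ⟨0, fun i l => by rw [Matrix.zero_mul]; rfl⟩
  add_mem' := by
    rintro P Q ⟨P₁, hP⟩ ⟨Q₁, hQ⟩
    refine ⟨P₁ + Q₁, fun i l => ?_⟩
    rw [Matrix.add_mul]
    exact congrArg₂ (· + ·) (hP i l) (hQ i l)
  smul_mem' := by
    rintro c P ⟨P₁, hP⟩
    refine ⟨c • P₁, fun i l => ?_⟩
    rw [Matrix.smul_mul]
    exact congrArg (c • ·) (hP i l)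

variable {A r hr} in
/-- An element of `truncObsSpace A r hr` as a matrix. -/
def toMatrix (P : truncObsSpace A r hr) : Matrix (Σ i : Fin d, Fin (r i)) (Fin d) ℝ :=
  Matrix.of P.1

theorem isOpen_rank_eq : IsOpen {P : truncObsSpace A r hr | (toMatrix P).rank = d} := by
  have h : {P : truncObsSpace A r hr | (toMatrix P).rank = d}
      = {P : truncObsSpace A r hr | ((toMatrix P).transpose * toMatrix P).det ≠ 0} := by
    ext P
    simp only [Set.mem_ofPred_eq]
    rw [← Matrix.rank_transpose_mul_self, ← isUnit_iff_ne_zero,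
      ← Matrix.isUnit_iff_isUnit_det]
    constructor
    · intro h
      rw [← Matrix.linearIndependent_cols_iff_isUnit, linearIndependent_iff_card_eq_finrank_span,
        Set.finrank, ← Matrix.rank_eq_finrank_span_cols, h, Fintype.card_fin]
    · intro h
      simpa using Matrix.rank_of_isUnit _ h
  have hc : Continuous (toMatrix : truncObsSpace A r hr → _) := continuous_subtype_val
  rw [h]
  exact isOpen_ne_fun (((hc.matrix_transpose).matrix_mul hc).matrix_det) continuous_const

/-- The manifold `𝒫_(A;r)` of the matrices of rank `d` in the space above. It is an open subset
of that vector space and has the manifold structure of such a subset. -/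
def truncObs : TopologicalSpace.Opens (truncObsSpace A r hr) :=
  ⟨{P | (toMatrix P).rank = d}, isOpen_rank_eq A r hr⟩

variable {A r hr}

/-- The matrix product `P X` of `P ∈ 𝒫_(A;r)` and `X ∈ C̃_A`, which is again in `𝒫_(A;r)`. -/
def rightMul (P : truncObs A r hr) (X : invCentralizer A) : truncObs A r hr :=
  ⟨⟨toMatrix P.1 * ((X : GL (Fin d) ℝ) : Matrix (Fin d) (Fin d) ℝ), by
    obtain ⟨P₁, hP⟩ := P.1.2
    refine ⟨P₁ * ((X : GL (Fin d) ℝ) : Matrix (Fin d) (Fin d) ℝ), fun i l => ?_⟩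
    have hX : Commute ((X : GL (Fin d) ℝ) : Matrix (Fin d) (Fin d) ℝ) A :=
      mem_centralizer_iff.1 X.2
    rw [Matrix.mul_assoc, (hX.pow_right (i : ℕ)).eq, ← Matrix.mul_assoc]
    exact congrArg (fun v : Fin d → ℝ => Matrix.vecMul v
      ((X : GL (Fin d) ℝ) : Matrix (Fin d) (Fin d) ℝ)) (hP i l)⟩, by
    change (toMatrix P.1 * ((X : GL (Fin d) ℝ) : Matrix (Fin d) (Fin d) ℝ)).rank = d
    rw [Matrix.rank_mul_eq_left_of_isUnit_det _ _
      ((Matrix.isUnit_iff_isUnit_det _).1 (X : GL (Fin d) ℝ).isUnit)]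
    exact P.2⟩

instance instSMulTruncObs : SMul (invCentralizer A)ᵐᵒᵖ (truncObs A r hr) :=
  ⟨fun X P => rightMul P X.unop⟩

/-- The action of `C̃_A` on `𝒫_(A;r)` by right multiplication, as an action of the opposite
group: `op X • P = P X`. -/
instance instMulActionTruncObs : MulAction (invCentralizer A)ᵐᵒᵖ (truncObs A r hr) where
  one_smul P := Subtype.ext (Subtype.ext (Matrix.mul_one (toMatrix P.1)))
  mul_smul X Y P := Subtype.ext (Subtype.ext
    (Matrix.mul_assoc (toMatrix P.1) ((Y.unop : GL (Fin d) ℝ) : Matrix (Fin d) (Fin d) ℝ)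
      ((X.unop : GL (Fin d) ℝ) : Matrix (Fin d) (Fin d) ℝ)).symm)

end

/-- The orbit space `𝒫_(A;r) / C̃_A`, with the quotient topology. -/
abbrev OrbitSpace {d : ℕ} [NeZero d] (A : Matrix (Fin d) (Fin d) ℝ) (r : Fin d → ℕ)
    (hr : Antitone r) : Type :=
  Quotient (MulAction.orbitRel (invCentralizer A)ᵐᵒᵖ (truncObs A r hr))

/-- The natural projection `𝒫_(A;r) → 𝒫_(A;r) / C̃_A`. -/
def orbitProj {d : ℕ} [NeZero d] (A : Matrix (Fin d) (Fin d) ℝ) (r : Fin d → ℕ)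
    (hr : Antitone r) (P : truncObs A r hr) : OrbitSpace A r hr :=
  Quotient.mk _ P

end TruncObs

/-! The invertible centralizer is the unit group of the finite-dimensional algebra `C = C_A`, which
acts linearly on the right of the space `V` of structured matrices. Full column rank gives `P` a
left inverse `P⁺`, continuous in `P`, so `P X = Q` forces `X = P⁺ Q`. This gives freeness, even
injectivity of `X ↦ P X` on all of `C`. It also gives properness: `(P X, P)` determines `X`
continuously, and the set of such pairs is closed (`properSMul`). The Hausdorff property of the
quotient follows from properness; its second countability is inherited along the open projection.

The manifold structure comes from affine slices. At a point `v` with `x ↦ v x` injective, split `V ≃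
E × C` so that `v x` becomes `(0, x)` (`exists_mem_regular`). For `w` near `v` the map sending `x`
to the `C`-component of `w x` is still invertible, so exactly one `x` moves `w` into the slice `E ×
{1}`, and it depends smoothly on `w`. The `E`-component of the moved point is constant on orbits and
serves as chart of the quotient. Together with `x` it gives a chart of `V` in which the projection
is `E × C → E`, hence a submersion. The dimension of `E` is `dim V - dim C`, and `dim V = r d`
because the first block determines `P`. -/

section

open Set Manifold TopologicalSpace

/-- A continuous bilinear right action of a normed algebra `C` on a normed space `V`. -/
structure RightAction (V C : Type*) [NormedAddCommGroup V] [NormedSpace ℝ V]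
    [NormedRing C] [NormedAlgebra ℝ C] where
  /-- the bilinear map `(v, x) ↦ v x` -/
  act : V →L[ℝ] C →L[ℝ] V
  act_one : ∀ v, act v 1 = v
  act_act : ∀ v x y, act (act v x) y = act v (x * y)

/-! ### Normal forms relative to an affine slice. -/

namespace RightAction

variable {V C E : Type*} [NormedAddCommGroup V] [NormedSpace ℝ V]
  [NormedRing C] [NormedAlgebra ℝ C] [NormedAddCommGroup E] [NormedSpace ℝ E]
  (ρ : RightAction V C) (e : V ≃L[ℝ] (E × C))

/-- The endomorphism `x ↦ (e (v x)).2` of `C`, linear in `v`. -/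
noncomputable def transfer : V →L[ℝ] (C →L[ℝ] C) :=
  (ContinuousLinearMap.compL ℝ C V C
    ((ContinuousLinearMap.snd ℝ E C).comp (e : V →L[ℝ] (E × C)))).comp ρ.act

theorem transfer_apply (v : V) (x : C) : ρ.transfer e v x = (e (ρ.act v x)).2 := rfl

/-- The element `x` of `C` for which the `C`-component of `v x` is `1`. -/
noncomputable def normalizer (v : V) : C := Ring.inverse (ρ.transfer e v) 1

/-- The `E`-component of the normal form of `v`. -/
noncomputable def sliceCoord (v : V) : E := (e (ρ.act v (ρ.normalizer e v))).1

/-- The element of the affine slice with given `E`-component. -/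
noncomputable def slice (y : E) : V := e.symm (y, 1)

/-- The elements of `V` which have a unique normal form in their orbit. -/
def regular : Set V := {v | IsUnit (ρ.transfer e v) ∧ IsUnit (ρ.normalizer e v)}

theorem e_slice (y : E) : e (slice e y) = (y, 1) := by simp [slice]

theorem transfer_act (v : V) (x : C) :
    ρ.transfer e (ρ.act v x) = ρ.transfer e v * ContinuousLinearMap.mul ℝ C x := by
  ext z
  simp [transfer_apply, ρ.act_act]

theorem isUnit_mul (u : Cˣ) : IsUnit (ContinuousLinearMap.mul ℝ C (u : C)) := by
  refine ⟨⟨ContinuousLinearMap.mul ℝ C u, ContinuousLinearMap.mul ℝ C ((u⁻¹ : Cˣ) : C), ?_, ?_⟩, rfl⟩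
    <;> ext z <;> simp

theorem inverse_mul (u : Cˣ) : Ring.inverse (ContinuousLinearMap.mul ℝ C (u : C)) =
    ContinuousLinearMap.mul ℝ C ((u⁻¹ : Cˣ) : C) := by
  refine Ring.inverse_unit (⟨ContinuousLinearMap.mul ℝ C u,
    ContinuousLinearMap.mul ℝ C ((u⁻¹ : Cˣ) : C), ?_, ?_⟩ : (C →L[ℝ] C)ˣ)
    <;> ext z <;> simp

/-- Since `(v u)(u⁻¹ x) = v x`, an `x` that normalizes `v` yields `u⁻¹ x` for `v u`. No regularity
is needed, so `sliceCoord` is invariant on all of `V`. -/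
theorem normalizer_act (v : V) (u : Cˣ) :
    ρ.normalizer e (ρ.act v u) = ((u⁻¹ : Cˣ) : C) * ρ.normalizer e v := by
  unfold normalizer
  rw [transfer_act]
  by_cases h : IsUnit (ρ.transfer e v)
  · obtain ⟨t, ht⟩ := h
    obtain ⟨w, hw⟩ := isUnit_mul u
    have : Ring.inverse (ρ.transfer e v * ContinuousLinearMap.mul ℝ C (u : C)) =
        Ring.inverse (ContinuousLinearMap.mul ℝ C (u : C)) * Ring.inverse (ρ.transfer e v) := by
      rw [← ht, ← hw, ← Units.val_mul, Ring.inverse_unit, Ring.inverse_unit, Ring.inverse_unit,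
        mul_inv_rev, Units.val_mul]
    rw [this, inverse_mul]
    simp
  -- Neither transfer map is invertible here, and `Ring.inverse` takes the value `0` at both.
  · rw [Ring.inverse_non_unit _ h, Ring.inverse_non_unit]
    · simp
    · intro h'
      apply h
      obtain ⟨w, hw⟩ := isUnit_mul u
      rw [← hw] at h'
      exact (Units.isUnit_mul_units _ _).1 h'

theorem sliceCoord_act (v : V) (u : Cˣ) : ρ.sliceCoord e (ρ.act v u) = ρ.sliceCoord e v := by
  simp [sliceCoord, normalizer_act, ρ.act_act]

theorem act_mem_regular {v : V} (u : Cˣ) (h : v ∈ ρ.regular e) : ρ.act v u ∈ ρ.regular e := by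
  refine ⟨?_, ?_⟩
  · rw [transfer_act]; exact h.1.mul (isUnit_mul u)
  · rw [normalizer_act]; exact u⁻¹.isUnit.mul h.2

variable {e} in
theorem transfer_normalizer {v : V} (h : v ∈ ρ.regular e) :
    ρ.transfer e v (ρ.normalizer e v) = 1 := by
  have := congrArg (fun f : C →L[ℝ] C => f 1) (Ring.mul_inverse_cancel _ h.1)
  simpa [normalizer] using this

variable {e} in
theorem slice_sliceCoord {v : V} (h : v ∈ ρ.regular e) :
    slice e (ρ.sliceCoord e v) = ρ.act v (ρ.normalizer e v) := by
  apply e.injective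
  rw [e_slice]
  refine Prod.ext rfl ?_
  exact (ρ.transfer_normalizer h).symm

/-- An element of the slice at which the transfer map is invertible is in normal form. -/
theorem normalizer_slice {y : E} (h : IsUnit (ρ.transfer e (slice e y))) :
    ρ.normalizer e (slice e y) = 1 := by
  have h1 : ρ.transfer e (slice e y) 1 = 1 := by
    rw [transfer_apply, ρ.act_one, e_slice]
  have := congrArg (fun f : C →L[ℝ] C => f 1) (Ring.inverse_mul_cancel _ h)
  simpa [normalizer, h1] using this

variable {e} in
theorem sliceCoord_slice {y : E} (h : slice e y ∈ ρ.regular e) :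
    ρ.sliceCoord e (slice e y) = y := by
  rw [sliceCoord, normalizer_slice ρ e h.1, ρ.act_one, e_slice]

variable {e} in
theorem exists_unit_slice {v : V} (h : v ∈ ρ.regular e) :
    ∃ u : Cˣ, slice e (ρ.sliceCoord e v) = ρ.act v u := by
  obtain ⟨u, hu⟩ := h.2
  exact ⟨u, by rw [ρ.slice_sliceCoord h, hu]⟩

variable {e} in
theorem slice_sliceCoord_mem_regular {v : V} (h : v ∈ ρ.regular e) :
    slice e (ρ.sliceCoord e v) ∈ ρ.regular e := by
  obtain ⟨u, hu⟩ := ρ.exists_unit_slice h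
  rw [hu]
  exact ρ.act_mem_regular e u h

theorem continuous_slice : Continuous (slice e) := by
  unfold slice; fun_prop

theorem contDiff_slice : ContDiff ℝ ∞ (slice e) := by
  unfold slice
  exact e.symm.contDiff.comp (contDiff_id.prodMk contDiff_const)

/-! ### Smoothness of the normal form and straightening of the orbits. -/

variable [CompleteSpace C]

/-- Inversion in the Banach algebra of endomorphisms of `C` is smooth at units, and `transfer` is
linear in `v`. -/
theorem contDiffAt_normalizer {v : V} (h : IsUnit (ρ.transfer e v)) :
    ContDiffAt ℝ ∞ (ρ.normalizer e) v := by
  obtain ⟨u, hu⟩ := h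
  have h1 : ContDiffAt ℝ ∞ (Ring.inverse : (C →L[ℝ] C) → _) (ρ.transfer e v) :=
    hu ▸ contDiffAt_ringInverse ℝ u
  have h2 : ContDiffAt ℝ ∞ (fun w => Ring.inverse (ρ.transfer e w)) v :=
    h1.comp v (ρ.transfer e).contDiff.contDiffAt
  exact h2.clm_apply contDiffAt_const

theorem contDiffAt_act_normalizer {v : V} (h : IsUnit (ρ.transfer e v)) :
    ContDiffAt ℝ ∞ (fun w => ρ.act w (ρ.normalizer e w)) v :=
  (ρ.act.contDiff.contDiffAt).clm_apply (ρ.contDiffAt_normalizer e h)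

theorem contDiffOn_sliceCoord : ContDiffOn ℝ ∞ (ρ.sliceCoord e) (ρ.regular e) := by
  intro v hv
  exact (contDiff_fst.contDiffAt.comp v (e.contDiff.contDiffAt.comp v
    (ρ.contDiffAt_act_normalizer e hv.1))).contDiffWithinAt

theorem isOpen_regular : IsOpen (ρ.regular e) := by
  rw [isOpen_iff_mem_nhds]
  intro v hv
  have h1 : ∀ᶠ w in 𝓝 v, IsUnit (ρ.transfer e w) :=
    (Units.isOpen.preimage (ρ.transfer e).continuous).mem_nhds hv.1
  have h2 : ∀ᶠ w in 𝓝 v, IsUnit (ρ.normalizer e w) :=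
    (ρ.contDiffAt_normalizer e hv.1).continuousAt.eventually (Units.isOpen.mem_nhds hv.2)
  exact h1.and h2

/-- The local trivialization `V ⊇ regular → E × C ≃ V` adapted to the orbits. -/
noncomputable def straighten (U : Opens V) (hU : ∀ v ∈ U, ∀ u : Cˣ, ρ.act v u ∈ U) :
    OpenPartialHomeomorph V V where
  toFun v := e.symm (ρ.sliceCoord e v, ρ.normalizer e v)
  -- The normalizer carries `v` to its slice point, so its inverse carries the slice point back to
  -- `v`.
  invFun w := ρ.act (slice e (e w).1) (Ring.inverse (e w).2)
  source := U ∩ ρ.regular e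
  target := {w | slice e (e w).1 ∈ U ∧ slice e (e w).1 ∈ ρ.regular e ∧ IsUnit (e w).2}
  map_source' v hv := by
    obtain ⟨u, hu⟩ := ρ.exists_unit_slice hv.2
    refine ⟨?_, ?_, ?_⟩
    · simp only [ContinuousLinearEquiv.apply_symm_apply]; rw [hu]; exact hU v hv.1 u
    · simpa using ρ.slice_sliceCoord_mem_regular hv.2
    · simpa using hv.2.2
  map_target' w hw := by
    obtain ⟨h1, h2, u, hu⟩ := hw
    rw [← hu, Ring.inverse_unit]
    exact ⟨hU _ h1 _, ρ.act_mem_regular e _ h2⟩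
  left_inv' v hv := by
    obtain ⟨u, hu⟩ := hv.2.2
    simp only [ContinuousLinearEquiv.apply_symm_apply]
    rw [ρ.slice_sliceCoord hv.2, ρ.act_act, Ring.mul_inverse_cancel _ hv.2.2, ρ.act_one]
  right_inv' w hw := by
    obtain ⟨h1, h2, u, hu⟩ := hw
    rw [← hu, Ring.inverse_unit, ρ.sliceCoord_act, ρ.normalizer_act, ρ.sliceCoord_slice h2,
      ρ.normalizer_slice e h2.1, inv_inv, mul_one, hu]
    simp
  open_source := U.isOpen.inter (ρ.isOpen_regular e)
  open_target := by
    have h : Continuous fun w => slice e (e w).1 := (continuous_slice e).comp (by fun_prop)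
    exact (U.isOpen.preimage h).inter (((ρ.isOpen_regular e).preimage h).inter
      (Units.isOpen.preimage (by fun_prop)))
  continuousOn_toFun := by
    refine e.symm.continuous.comp_continuousOn (ContinuousOn.prodMk ?_ ?_)
    · exact (ρ.contDiffOn_sliceCoord e).continuousOn.mono inter_subset_right
    · exact fun v hv =>
        (ρ.contDiffAt_normalizer e hv.2.1).continuousAt.continuousWithinAt
  continuousOn_invFun := by
    intro w hw
    obtain ⟨h1, h2, u, hu⟩ := hw
    have h : Continuous fun w => slice e (e w).1 := (continuous_slice e).comp (by fun_prop)
    have hi : ContinuousAt Ring.inverse (e w).2 := hu ▸ NormedRing.inverse_continuousAt u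
    have hi' : ContinuousAt (fun w => Ring.inverse (e w).2) w :=
      ContinuousAt.comp (f := fun w => (e w).2) hi (by fun_prop)
    exact (((ρ.act.continuous.comp h).continuousAt).clm_apply hi').continuousWithinAt

theorem straighten_apply (U : Opens V) (hU : ∀ v ∈ U, ∀ u : Cˣ, ρ.act v u ∈ U) (v : V) :
    ρ.straighten e U hU v = e.symm (ρ.sliceCoord e v, ρ.normalizer e v) := rfl

theorem contDiffOn_straighten (U : Opens V) (hU : ∀ v ∈ U, ∀ u : Cˣ, ρ.act v u ∈ U) :
    ContDiffOn ℝ ∞ (ρ.straighten e U hU) (ρ.straighten e U hU).source := by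
  refine e.symm.contDiff.comp_contDiffOn (ContDiffOn.prodMk ?_ ?_)
  · exact (ρ.contDiffOn_sliceCoord e).mono inter_subset_right
  · exact fun v hv => (ρ.contDiffAt_normalizer e hv.2.1).contDiffWithinAt

theorem contDiffOn_straighten_symm (U : Opens V) (hU : ∀ v ∈ U, ∀ u : Cˣ, ρ.act v u ∈ U) :
    ContDiffOn ℝ ∞ (ρ.straighten e U hU).symm (ρ.straighten e U hU).target := by
  intro w hw
  obtain ⟨h1, h2, u, hu⟩ := hw
  have h : ContDiff ℝ ∞ fun w => slice e (e w).1 :=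
    (contDiff_slice e).comp (contDiff_fst.comp e.contDiff)
  have hi : ContDiffAt ℝ ∞ Ring.inverse (e w).2 := hu ▸ contDiffAt_ringInverse ℝ u
  have hi' : ContDiffAt ℝ ∞ (fun w => Ring.inverse (e w).2) w :=
    ContDiffAt.comp (f := fun w => (e w).2) w hi (contDiff_snd.comp e.contDiff).contDiffAt
  exact (((ρ.act.contDiff.comp h).contDiffAt).clm_apply hi').contDiffWithinAt

/-- The charts of `U` are restrictions of the identity of `V`, so the transition maps are
restrictions of `straighten` and its inverse, both smooth. -/
theorem straighten_subtypeRestr_mem_maximalAtlas (U : Opens V)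
    (hU : ∀ v ∈ U, ∀ u : Cˣ, ρ.act v u ∈ U) (hne : Nonempty U) :
    (ρ.straighten e U hU).subtypeRestr hne ∈ IsManifold.maximalAtlas 𝓘(ℝ, V) ∞ U := by
  have hG : ρ.straighten e U hU ∈ contDiffGroupoid ∞ 𝓘(ℝ, V) := by
    rw [contDiffGroupoid, mem_groupoid_of_pregroupoid]
    refine ⟨?_, ?_⟩
    · simpa [contDiffPregroupoid] using ρ.contDiffOn_straighten e U hU
    · simpa [contDiffPregroupoid] using ρ.contDiffOn_straighten_symm e U hU
  intro e' he'
  obtain ⟨x, rfl⟩ := Opens.chart_eq hne he'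
  simp only [chartAt_self_eq]
  constructor
  · refine (contDiffGroupoid ∞ 𝓘(ℝ, V)).mem_of_eqOnSource ?_
      (OpenPartialHomeomorph.subtypeRestr_symm_trans_subtypeRestr hne _ _)
    refine closedUnderRestriction' ?_
      ((ρ.straighten e U hU).isOpen_inter_preimage_symm U.2)
    exact (contDiffGroupoid ∞ 𝓘(ℝ, V)).trans ((contDiffGroupoid ∞ 𝓘(ℝ, V)).symm hG)
      ((contDiffGroupoid ∞ 𝓘(ℝ, V)).id_mem)
  · refine (contDiffGroupoid ∞ 𝓘(ℝ, V)).mem_of_eqOnSource ?_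
      (OpenPartialHomeomorph.subtypeRestr_symm_trans_subtypeRestr hne _ _)
    refine closedUnderRestriction' ?_
      ((OpenPartialHomeomorph.refl V).isOpen_inter_preimage_symm U.2)
    exact (contDiffGroupoid ∞ 𝓘(ℝ, V)).trans ((contDiffGroupoid ∞ 𝓘(ℝ, V)).symm
      ((contDiffGroupoid ∞ 𝓘(ℝ, V)).id_mem)) hG

/-! ### Charts of the quotient. -/

section Quotient

variable {V C E : Type} [NormedAddCommGroup V] [NormedSpace ℝ V]
  [NormedRing C] [NormedAlgebra ℝ C] [NormedAddCommGroup E] [NormedSpace ℝ E]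
  (ρ : RightAction V C) (e e' : V ≃L[ℝ] (E × C))
  {U : Opens V} {s : Setoid U}

open Classical in
/-- The class of a point of the slice, with default value `v₀` outside of `U`. -/
noncomputable def sliceClass (s : Setoid U) (v₀ : U) (y : E) : Quotient s :=
  if h : slice e y ∈ U then Quotient.mk s ⟨slice e y, h⟩ else Quotient.mk s v₀

theorem sliceClass_of_mem (v₀ : U) {y : E} (h : slice e y ∈ U) :
    sliceClass e s v₀ y = Quotient.mk s ⟨slice e y, h⟩ := dif_pos h

theorem sliceClass_sliceCoord (hU : ∀ v ∈ U, ∀ u : Cˣ, ρ.act v u ∈ U)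
    (hs : ∀ v w : U, s v w ↔ ∃ u : Cˣ, ρ.act w.1 u = v.1)
    (v₀ : U) {v : U} (h : v.1 ∈ ρ.regular e) :
    sliceClass e s v₀ (ρ.sliceCoord e v) = Quotient.mk s v := by
  obtain ⟨u, hu⟩ := ρ.exists_unit_slice h
  have hm : slice e (ρ.sliceCoord e v.1) ∈ U := hu ▸ hU v v.2 u
  rw [sliceClass_of_mem e v₀ hm]
  exact Quotient.sound ((hs _ _).2 ⟨u, hu.symm⟩)

theorem sliceCoord_congr (hs : ∀ v w : U, s v w ↔ ∃ u : Cˣ, ρ.act w.1 u = v.1)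
    {v w : U} (h : s v w) : ρ.sliceCoord e v = ρ.sliceCoord e w := by
  obtain ⟨u, hu⟩ := (hs v w).1 h
  rw [← hu, sliceCoord_act]

theorem mem_regular_congr (hs : ∀ v w : U, s v w ↔ ∃ u : Cˣ, ρ.act w.1 u = v.1)
    {v w : U} (h : s v w) : v.1 ∈ ρ.regular e ↔ w.1 ∈ ρ.regular e := by
  have key : ∀ {v w : U}, s v w → w.1 ∈ ρ.regular e → v.1 ∈ ρ.regular e := by
    intro v w h hw
    obtain ⟨u, hu⟩ := (hs v w).1 h
    rw [← hu]
    exact ρ.act_mem_regular e u hw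
  exact ⟨key (s.symm h), key h⟩

variable [CompleteSpace C] (hU : ∀ v ∈ U, ∀ u : Cˣ, ρ.act v u ∈ U)
  (hs : ∀ v w : U, s v w ↔ ∃ u : Cˣ, ρ.act w.1 u = v.1)
  (hq : IsOpenQuotientMap (Quotient.mk s))

/-- The chart of the quotient of `U` given by the slice of `e`. -/
noncomputable def quotientChart (v₀ : U) : OpenPartialHomeomorph (Quotient s) E where
  toFun := Quotient.lift (fun v : U => ρ.sliceCoord e v) fun _ _ h => ρ.sliceCoord_congr e hs h
  invFun := sliceClass e s v₀
  source := {x | Quotient.lift (fun v : U => v.1 ∈ ρ.regular e)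
    (fun _ _ h => propext (ρ.mem_regular_congr e hs h)) x}
  target := {y | slice e y ∈ U ∧ slice e y ∈ ρ.regular e}
  map_source' := by
    rintro ⟨v⟩ (hv : v.1 ∈ ρ.regular e)
    refine ⟨?_, ρ.slice_sliceCoord_mem_regular hv⟩
    obtain ⟨u, hu⟩ := ρ.exists_unit_slice hv
    exact (congrArg (· ∈ U) hu).mpr (hU v v.2 u)
  map_target' y hy := by
    rw [sliceClass_of_mem e v₀ hy.1]
    exact hy.2
  left_inv' := by
    rintro ⟨v⟩ (hv : v.1 ∈ ρ.regular e)
    exact ρ.sliceClass_sliceCoord e hU hs v₀ hv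
  right_inv' y hy := by
    rw [sliceClass_of_mem e v₀ hy.1]
    exact ρ.sliceCoord_slice hy.2
  open_source := by
    rw [← hq.isQuotientMap.isOpen_preimage]
    exact (ρ.isOpen_regular e).preimage continuous_subtype_val
  open_target := (U.isOpen.inter (ρ.isOpen_regular e)).preimage (continuous_slice e)
  continuousOn_toFun := by
    have ho : IsOpen {x | Quotient.lift (fun v : U => v.1 ∈ ρ.regular e)
        (fun _ _ h => propext (ρ.mem_regular_congr e hs h)) x} := by
      rw [← hq.isQuotientMap.isOpen_preimage]
      exact (ρ.isOpen_regular e).preimage continuous_subtype_val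
    rintro ⟨v⟩ (hv : v.1 ∈ ρ.regular e)
    refine ContinuousAt.continuousWithinAt ?_
    have h1 : ContinuousAt (fun v : U => ρ.sliceCoord e v) v :=
      ContinuousAt.comp (f := fun v : U => v.1)
        ((ρ.contDiffOn_sliceCoord e).continuousOn.continuousAt
          ((ρ.isOpen_regular e).mem_nhds hv)) continuous_subtype_val.continuousAt
    exact hq.continuousAt_comp_iff.1 h1
  continuousOn_invFun := by
    intro y hy
    rw [continuousWithinAt_iff_continuousAt_domRestrict _ hy]
    refine Continuous.continuousAt ?_
    have : (({y | slice e y ∈ U ∧ slice e y ∈ ρ.regular e}).domRestrict (sliceClass e s v₀)) =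
        fun y : {y | slice e y ∈ U ∧ slice e y ∈ ρ.regular e} =>
          Quotient.mk s ⟨slice e y.1, y.2.1⟩ := by
      funext y
      exact sliceClass_of_mem e v₀ y.2.1
    rw [this]
    exact hq.continuous.comp (((continuous_slice e).comp continuous_subtype_val).subtype_mk _)

theorem mk_mem_quotientChart_source (v₀ v : U) :
    Quotient.mk s v ∈ (ρ.quotientChart e hU hs hq v₀).source ↔ v.1 ∈ ρ.regular e := Iff.rfl

theorem quotientChart_symm (v₀ : U) (y : E) :
    (ρ.quotientChart e hU hs hq v₀).symm y = sliceClass e s v₀ y := rfl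

/-- The inverse chart lifts to the smooth map `slice e` into `V`, so the transition map is
`sliceCoord` of `e'` after `slice e`. -/
theorem contDiffOn_quotientChart_trans (v₀ w₀ : U) :
    ContDiffOn ℝ ∞ ((ρ.quotientChart e hU hs hq v₀).symm ≫ₕ ρ.quotientChart e' hU hs hq w₀)
      ((ρ.quotientChart e hU hs hq v₀).symm ≫ₕ ρ.quotientChart e' hU hs hq w₀).source := by
  have hmem : ∀ y ∈ ((ρ.quotientChart e hU hs hq v₀).symm ≫ₕ
      ρ.quotientChart e' hU hs hq w₀).source,
      ∃ h : slice e y ∈ U, slice e y ∈ ρ.regular e' := by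
    intro y hy
    rw [OpenPartialHomeomorph.trans_source] at hy
    have h1 : slice e y ∈ U := hy.1.1
    refine ⟨h1, ?_⟩
    have h2 := hy.2
    rw [mem_preimage, quotientChart_symm, sliceClass_of_mem e v₀ h1] at h2
    exact h2
  have h := (ρ.contDiffOn_sliceCoord e').comp
    ((contDiff_slice e).contDiffOn (s := ((ρ.quotientChart e hU hs hq v₀).symm ≫ₕ
      ρ.quotientChart e' hU hs hq w₀).source)) (fun y hy => (hmem y hy).2)
  refine h.congr fun y hy => ?_
  rw [OpenPartialHomeomorph.trans_apply, quotientChart_symm,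
    sliceClass_of_mem e v₀ (hmem y hy).1]
  rfl

end Quotient

/-! ### Slices at free points and the quotient manifold theorem. -/

section Complement

variable {V C : Type} [NormedAddCommGroup V] [NormedSpace ℝ V] [FiniteDimensional ℝ V]
  [NormedRing C] [NormedAlgebra ℝ C]
  (ρ : RightAction V C)

/-- At a point with free orbit, some linear splitting of `V` makes the point regular. -/
theorem exists_mem_regular {m : ℕ} (hm : m + Module.finrank ℝ C = Module.finrank ℝ V) {v : V}
    (hv : Function.Injective (ρ.act v)) :
    ∃ e : V ≃L[ℝ] (EuclideanSpace ℝ (Fin m) × C), v ∈ ρ.regular e := by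
  set W := LinearMap.range (ρ.act v : C →ₗ[ℝ] V) with hW
  obtain ⟨K, hK⟩ := W.exists_isCompl
  let j : C ≃ₗ[ℝ] W := LinearEquiv.ofInjective (ρ.act v : C →ₗ[ℝ] V) hv
  have hd : Module.finrank ℝ K = Module.finrank ℝ (EuclideanSpace ℝ (Fin m)) := by
    have h1 := Submodule.finrank_add_eq_of_isCompl hK
    have h2 := j.finrank_eq
    rw [finrank_euclideanSpace_fin]
    omega
  let i : K ≃ₗ[ℝ] EuclideanSpace ℝ (Fin m) := LinearEquiv.ofFinrankEq _ _ hd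
  let f : V ≃ₗ[ℝ] (EuclideanSpace ℝ (Fin m) × C) :=
    (Submodule.prodEquivOfIsCompl K W hK.symm).symm.trans (i.prodCongr j.symm)
  let e := f.toContinuousLinearEquiv
  -- The `C`-factor of the splitting is the tangent space `v C` of the orbit, so the transfer map at
  -- `v` is the identity and the normalizer is `1`.
  have he : ∀ x, e (ρ.act v x) = (0, x) := by
    intro x
    change f _ = _
    rw [← LinearEquiv.eq_symm_apply]
    simp only [f, j, LinearEquiv.trans_symm, LinearEquiv.symm_symm, LinearEquiv.trans_apply]
    simp
    rfl
  have ht : ρ.transfer e v = 1 := by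
    ext x
    rw [transfer_apply, he]
    rfl
  refine ⟨e, ?_, ?_⟩
  · rw [ht]; exact isUnit_one
  · simp [normalizer, ht]

variable [FiniteDimensional ℝ C]

/-- In finite dimensions every algebraic right action is continuous. -/
noncomputable def ofLinear (b : V →ₗ[ℝ] C →ₗ[ℝ] V) (h1 : ∀ v, b v 1 = v)
    (h2 : ∀ v x y, b (b v x) y = b v (x * y)) : RightAction V C where
  act := LinearMap.toContinuousLinearMap
    ((LinearMap.toContinuousLinearMap : (C →ₗ[ℝ] V) ≃ₗ[ℝ] (C →L[ℝ] V)).toLinearMap.comp b)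
  act_one := h1
  act_act := h2

/-- The quotient of an open set by the action of the group of units, if that action is free and
the quotient map is open, is a manifold onto which the projection is a submersion. -/
theorem exists_isManifold_quotient {m : ℕ} {U : Opens V}
    (hU : ∀ v ∈ U, ∀ u : Cˣ, ρ.act v u ∈ U) (hinj : ∀ v ∈ U, Function.Injective (ρ.act v))
    (hm : Nonempty U → m + Module.finrank ℝ C = Module.finrank ℝ V)
    {s : Setoid U} (hs : ∀ v w : U, s v w ↔ ∃ u : Cˣ, ρ.act w.1 u = v.1)
    (hq : IsOpenQuotientMap (Quotient.mk s)) :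
    ∃ _ : ChartedSpace (EuclideanSpace ℝ (Fin m)) (Quotient s),
      IsManifold (𝓡 m) ∞ (Quotient s) ∧
      Manifold.IsSubmersion 𝓘(ℝ, V) (𝓡 m) ∞ (Quotient.mk s) := by
  have : CompleteSpace C := FiniteDimensional.complete ℝ C
  have hreg : ∀ v : U, ∃ e : V ≃L[ℝ] (EuclideanSpace ℝ (Fin m) × C), v.1 ∈ ρ.regular e :=
    fun v => ρ.exists_mem_regular (hm ⟨v⟩) (hinj v v.2)
  choose e he using hreg
  let cs : ChartedSpace (EuclideanSpace ℝ (Fin m)) (Quotient s) :=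
    { atlas := Set.range fun v : U => ρ.quotientChart (e v) hU hs hq v
      chartAt := fun x => ρ.quotientChart (e x.out) hU hs hq x.out
      mem_chart_source := fun x => by
        have h := (ρ.mk_mem_quotientChart_source (e x.out) hU hs hq x.out x.out).2 (he x.out)
        rwa [Quotient.out_eq] at h
      chart_mem_atlas := fun x => ⟨x.out, rfl⟩ }
  have hman : IsManifold (𝓡 m) ∞ (Quotient s) := by
    refine isManifold_of_contDiffOn _ _ _ ?_
    rintro _ _ ⟨v, rfl⟩ ⟨w, rfl⟩
    simpa using ρ.contDiffOn_quotientChart_trans (e v) (e w) hU hs hq v w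
  -- The orbit direction `C` is the complement, the same at every point.
  refine ⟨cs, hman, C, inferInstance, inferInstance, fun v => ?_⟩
  have hne : Nonempty U := ⟨v⟩
  refine IsSubmersionAtOfComplement.mk_of_continuousAt hq.continuous.continuousAt (e v)
    ((ρ.straighten (e v) U hU).subtypeRestr hne) (ρ.quotientChart (e v) hU hs hq v) ?_ (he v)
    (ρ.straighten_subtypeRestr_mem_maximalAtlas (e v) U hU hne)
    (IsManifold.subset_maximalAtlas ⟨v, rfl⟩) ?_
  · rw [OpenPartialHomeomorph.subtypeRestr_source]
    exact ⟨v.2, he v⟩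
  · intro w hw
    have hw' : w ∈ ((ρ.straighten (e v) U hU).subtypeRestr hne).target := by simpa using hw
    set z := ((ρ.straighten (e v) U hU).subtypeRestr hne).symm w with hz
    have h1 : ρ.straighten (e v) U hU z.1 = w :=
      ((ρ.straighten (e v) U hU).subtypeRestr hne).right_inv hw'
    -- In the straightened chart the projection is the first projection `E × C → E`.
    have h2 : (e v w).1 = ρ.sliceCoord (e v) z.1 := by
      rw [← h1]
      rw [straighten_apply, (e v).apply_symm_apply]
    simp only [Function.comp_apply, h2]
    rfl

end Complement

end RightAction

end

/-! ### Freeness and properness of the action on matrices of full rank. -/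

namespace TruncObs

variable {d : ℕ} {A : Matrix (Fin d) (Fin d) ℝ}

theorem isEmbedding_coe_invCentralizer (A : Matrix (Fin d) (Fin d) ℝ) :
    Topology.IsEmbedding
      fun X : invCentralizer A => ((X : GL (Fin d) ℝ) : Matrix (Fin d) (Fin d) ℝ) :=
  Topology.IsEmbedding.subtypeVal.comp (isOpenEmbedding_toCentralizer A).isEmbedding

variable [NeZero d] {r : Fin d → ℕ} {hr : Antitone r}

theorem isUnit_gram (P : truncObs A r hr) :
    IsUnit ((toMatrix P.1).transpose * toMatrix P.1) := by
  have h : (toMatrix P.1).rank = d := P.2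
  rw [← Matrix.linearIndependent_cols_iff_isUnit, linearIndependent_iff_card_eq_finrank_span,
    Set.finrank, ← Matrix.rank_eq_finrank_span_cols, Matrix.rank_transpose_mul_self, h,
    Fintype.card_fin]

/-- The Moore–Penrose left inverse of a matrix of full column rank. -/
noncomputable def leftInverse (P : truncObs A r hr) : Matrix (Fin d) (Σ i : Fin d, Fin (r i)) ℝ :=
  ((toMatrix P.1).transpose * toMatrix P.1)⁻¹ * (toMatrix P.1).transpose

theorem leftInverse_mul (P : truncObs A r hr) : leftInverse P * toMatrix P.1 = 1 := by
  rw [leftInverse, Matrix.mul_assoc, Matrix.nonsing_inv_mul _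
    ((Matrix.isUnit_iff_isUnit_det _).1 (isUnit_gram P))]

theorem mul_left_injective (P : truncObs A r hr) :
    Function.Injective fun X : Matrix (Fin d) (Fin d) ℝ => toMatrix P.1 * X := by
  intro X Y h
  have := congrArg (leftInverse P * ·) h
  simpa [← Matrix.mul_assoc, leftInverse_mul] using this

theorem continuous_toMatrix :
    Continuous fun P : truncObs A r hr => toMatrix P.1 := by
  have h : Continuous (toMatrix : truncObsSpace A r hr → _) := continuous_subtype_val
  exact h.comp continuous_subtype_val

theorem toMatrix_injective : Function.Injective fun P : truncObs A r hr => toMatrix P.1 :=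
  fun _ _ h => Subtype.ext (Subtype.ext h)

theorem isEmbedding_toMatrix :
    Topology.IsEmbedding fun P : truncObs A r hr => toMatrix P.1 := by
  have h : Topology.IsEmbedding (toMatrix : truncObsSpace A r hr → _) :=
    Topology.IsEmbedding.subtypeVal
  exact h.comp Topology.IsEmbedding.subtypeVal

theorem continuous_leftInverse :
    Continuous fun P : truncObs A r hr => leftInverse P := by
  have h : Continuous fun P : truncObs A r hr => (toMatrix P.1).transpose * toMatrix P.1 :=
    continuous_toMatrix.matrix_transpose.matrix_mul continuous_toMatrix
  have h' : Continuous fun P : truncObs A r hr =>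
      ((toMatrix P.1).transpose * toMatrix P.1)⁻¹ := by
    simp only [Matrix.inv_def, Ring.inverse_eq_inv']
    refine (h.matrix_det.inv₀ fun P => ?_).smul h.matrix_adjugate
    exact ((Matrix.isUnit_iff_isUnit_det _).1 (isUnit_gram P)).ne_zero
  exact h'.matrix_mul continuous_toMatrix.matrix_transpose

theorem eq_one_of_rightMul_eq (X : invCentralizer A) (P : truncObs A r hr)
    (h : rightMul P X = P) : X = 1 := by
  refine Subtype.ext (Units.ext (mul_left_injective P ?_))
  change toMatrix (rightMul P X).1 = toMatrix P.1 * 1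
  rw [h, Matrix.mul_one]

/-- An `X` with `X A = A X` and `P X = Q` is invertible, if `P` and `Q` have rank `d`. -/
theorem exists_rightMul_eq {P Q : truncObs A r hr} {X : Matrix (Fin d) (Fin d) ℝ}
    (hX : X * A = A * X) (h : toMatrix P.1 * X = toMatrix Q.1) :
    ∃ Y : invCentralizer A, rightMul P Y = Q := by
  -- `Q⁺ P X = Q⁺ Q = 1`, and a left-invertible square matrix is invertible.
  have h1 : leftInverse Q * toMatrix P.1 * X = 1 := by
    rw [Matrix.mul_assoc, h, leftInverse_mul]
  have hu : IsUnit X := IsUnit.of_mul_eq_one_right _ h1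
  obtain ⟨u, rfl⟩ := hu
  exact ⟨⟨u, mem_centralizer_iff.2 hX⟩, toMatrix_injective h⟩

instance properSMul : ProperSMul (invCentralizer A)ᵐᵒᵖ (truncObs A r hr) := by
  refine ⟨Topology.IsClosedEmbedding.isProperMap ?_⟩
  set f : (invCentralizer A)ᵐᵒᵖ × truncObs A r hr → truncObs A r hr × truncObs A r hr :=
    fun gx => (gx.1 • gx.2, gx.2) with hf
  -- `ψ` sends `(Q, P)` to `(P⁺ Q, P)` and thus recovers `(X, P)` from `(P X, P)`; this makes `f` an
  -- embedding.
  let ψ : truncObs A r hr × truncObs A r hr →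
      Matrix (Fin d) (Fin d) ℝ × truncObs A r hr :=
    fun q => (leftInverse q.2 * toMatrix q.1.1, q.2)
  have hψ : Continuous ψ :=
    ((continuous_leftInverse.comp continuous_snd).matrix_mul
      (continuous_toMatrix.comp continuous_fst)).prodMk continuous_snd
  have hcoe : Continuous fun X : (invCentralizer A)ᵐᵒᵖ =>
      ((X.unop : GL (Fin d) ℝ) : Matrix (Fin d) (Fin d) ℝ) :=
    (isEmbedding_coe_invCentralizer A).continuous.comp MulOpposite.continuous_unop
  have hfc : Continuous f := by
    refine Continuous.prodMk ?_ continuous_snd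
    rw [isEmbedding_toMatrix.continuous_iff]
    exact (continuous_toMatrix.comp continuous_snd).matrix_mul (hcoe.comp continuous_fst)
  have hcomp : ψ ∘ f = Prod.map (fun X : (invCentralizer A)ᵐᵒᵖ =>
      ((X.unop : GL (Fin d) ℝ) : Matrix (Fin d) (Fin d) ℝ)) id := by
    funext ⟨X, P⟩
    refine Prod.ext ?_ rfl
    change leftInverse P * (toMatrix P.1 *
      ((X.unop : GL (Fin d) ℝ) : Matrix (Fin d) (Fin d) ℝ)) = _
    rw [← Matrix.mul_assoc, leftInverse_mul, Matrix.one_mul]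
    rfl
  have hemb : Topology.IsEmbedding (ψ ∘ f) := by
    rw [hcomp]
    exact ((isEmbedding_coe_invCentralizer A).comp
      MulOpposite.opHomeomorph.symm.isEmbedding).prodMap Topology.IsEmbedding.id
  refine ⟨Topology.IsEmbedding.of_comp hfc hψ hemb, ?_⟩
  -- With `X = P⁺ Q`, the range is cut out by the closed conditions `X A = A X` and `P X = Q`.
  -- Invertibility of `X` is an open condition but follows from these, since `P` and `Q` both have
  -- rank `d`.
  have hrange : Set.range f = {q | (ψ q).1 * A = A * (ψ q).1} ∩
      {q | toMatrix q.2.1 * (ψ q).1 = toMatrix q.1.1} := by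
    ext ⟨Q, P⟩
    constructor
    · rintro ⟨⟨X, R⟩, h⟩
      rw [← h]
      have h' : (ψ (f (X, R))).1 = ((X.unop : GL (Fin d) ℝ) : Matrix (Fin d) (Fin d) ℝ) :=
        congrArg Prod.fst (congrFun hcomp (X, R))
      refine ⟨?_, ?_⟩
      · rw [Set.mem_ofPred_eq, h']
        exact mem_centralizer_iff.1 X.unop.2
      · rw [Set.mem_ofPred_eq, h']
        rfl
    · rintro ⟨h1, h2⟩
      obtain ⟨Y, hY⟩ := exists_rightMul_eq h1 h2
      exact ⟨(MulOpposite.op Y, P), Prod.ext hY rfl⟩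
  rw [hrange]
  have hX : Continuous fun q => (ψ q).1 := continuous_fst.comp hψ
  exact (isClosed_eq (hX.matrix_mul continuous_const) (continuous_const.matrix_mul hX)).inter
    (isClosed_eq ((continuous_toMatrix.comp continuous_snd).matrix_mul hX)
      (continuous_toMatrix.comp continuous_fst))

instance continuousConstSMul : ContinuousConstSMul (invCentralizer A)ᵐᵒᵖ (truncObs A r hr) :=
  ⟨fun X => (properSMul (A := A) (r := r) (hr := hr)).toContinuousSMul.continuous_smul.comp
    (Continuous.prodMk_right X)⟩

/-- The space of the matrices `P` is parametrized by the first block. -/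
theorem finrank_truncObsSpace :
    Module.finrank ℝ (truncObsSpace A r hr) = r 0 * d := by
  let f : Matrix (Fin (r 0)) (Fin d) ℝ →ₗ[ℝ] truncObsSpace A r hr :=
    { toFun := fun P₁ => ⟨fun p => (P₁ * A ^ (p.1 : ℕ)) (Fin.castLE (hr (Fin.zero_le p.1)) p.2),
        P₁, fun _ _ => rfl⟩
      map_add' := fun P Q => by
        ext p j
        simp [Matrix.add_mul]
      map_smul' := fun c P => by
        ext p j
        simp }
  have hf : Function.Bijective f := by
    constructor
    · intro P Q h
      funext l
      -- Block `0` carries the factor `A ^ 0 = 1`, so it is the first block itself.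
      have := congrFun (congrArg Subtype.val h) ⟨0, l⟩
      simpa [f] using this
    · rintro ⟨P, P₁, hP⟩
      exact ⟨P₁, Subtype.ext (funext fun p => (hP p.1 p.2).symm)⟩
  rw [← (LinearEquiv.ofBijective f hf).finrank_eq, Module.finrank_matrix]
  simp

/-! ### The centralizer algebra, its orbits and the dimension. -/

section

attribute [local instance] Matrix.linftyOpNormedRing Matrix.linftyOpNormedAlgebra

variable (A r hr) in
/-- The action of the centralizer on the linear space of the matrices `P`. -/
noncomputable def centralizerAction : RightAction (truncObsSpace A r hr) (centralizer A) :=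
  RightAction.ofLinear
    (LinearMap.mk₂ ℝ (fun (P : truncObsSpace A r hr) (X : centralizer A) =>
      (⟨toMatrix P * (X : Matrix (Fin d) (Fin d) ℝ), by
        obtain ⟨P₁, hP⟩ := P.2
        refine ⟨P₁ * (X : Matrix (Fin d) (Fin d) ℝ), fun i l => ?_⟩
        have hX : Commute (X : Matrix (Fin d) (Fin d) ℝ) A := mem_centralizer_iff.1 X.2
        rw [Matrix.mul_assoc, (hX.pow_right (i : ℕ)).eq, ← Matrix.mul_assoc]
        exact congrArg (fun v : Fin d → ℝ => Matrix.vecMul v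
          (X : Matrix (Fin d) (Fin d) ℝ)) (hP i l)⟩ : truncObsSpace A r hr))
      (fun P Q X => Subtype.ext (Matrix.add_mul (toMatrix P) (toMatrix Q) X.1))
      (fun c P X => Subtype.ext (Matrix.smul_mul c (toMatrix P) X.1))
      (fun P X Y => Subtype.ext (Matrix.mul_add (toMatrix P) X.1 Y.1))
      (fun c P X => Subtype.ext (Matrix.mul_smul (toMatrix P) c X.1)))
    (fun P => Subtype.ext (Matrix.mul_one (toMatrix P)))
    (fun P X Y => Subtype.ext (Matrix.mul_assoc (toMatrix P) X.1 Y.1))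

theorem centralizerAction_injective (P : truncObs A r hr) :
    Function.Injective ((centralizerAction A r hr).act P.1) := by
  intro X Y h
  exact Subtype.ext (mul_left_injective P (congrArg toMatrix h))

theorem centralizerAction_unit_mem (P : truncObsSpace A r hr) (hP : P ∈ truncObs A r hr)
    (u : (centralizer A)ˣ) : (centralizerAction A r hr).act P u ∈ truncObs A r hr := by
  change (toMatrix P * u.1.1).rank = d
  have hu : IsUnit u.1.1 := u.isUnit.map (centralizer A).val
  rw [Matrix.rank_mul_eq_left_of_isUnit_det _ _ ((Matrix.isUnit_iff_isUnit_det _).1 hu)]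
  exact hP

/-- The inverse of an invertible matrix commuting with `A` also commutes with `A`, so the invertible
centralizer and the units of the algebra `C_A` have the same orbits. -/
theorem orbitRel_iff (P Q : truncObs A r hr) :
    MulAction.orbitRel (invCentralizer A)ᵐᵒᵖ (truncObs A r hr) P Q ↔
      ∃ u : (centralizer A)ˣ, (centralizerAction A r hr).act Q.1 u = P.1 := by
  rw [MulAction.orbitRel_apply]
  constructor
  · rintro ⟨X, h⟩
    have hX := X.unop.2
    have hX' := (X.unop⁻¹).2
    refine ⟨⟨⟨_, hX⟩, ⟨_, hX'⟩, Subtype.ext ?_, Subtype.ext ?_⟩, congrArg Subtype.val h⟩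
    · exact Units.mul_inv (X.unop : GL (Fin d) ℝ)
    · exact Units.inv_mul (X.unop : GL (Fin d) ℝ)
  · rintro ⟨u, h⟩
    obtain ⟨Y, hY⟩ := exists_rightMul_eq (P := Q) (Q := P) (mem_centralizer_iff.1 u.1.2)
      (congrArg toMatrix h)
    exact ⟨MulOpposite.op Y, hY⟩

theorem exists_isManifold_orbitSpace {m : ℕ}
    (hm : Nonempty (truncObs A r hr) → m + dimInvCentralizer A = r 0 * d) :
    ∃ _ : ChartedSpace (EuclideanSpace ℝ (Fin m)) (OrbitSpace A r hr),
      IsManifold (𝓡 m) ∞ (OrbitSpace A r hr) ∧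
      Manifold.IsSubmersion 𝓘(ℝ, truncObsSpace A r hr) (𝓡 m) ∞ (orbitProj A r hr) :=
  (centralizerAction A r hr).exists_isManifold_quotient centralizerAction_unit_mem
    (fun P hP => centralizerAction_injective ⟨P, hP⟩)
    (fun h => (hm h).trans finrank_truncObsSpace.symm) orbitRel_iff
    MulAction.isOpenQuotientMap_quotientMk

theorem dimInvCentralizer_le (P : truncObs A r hr) : dimInvCentralizer A ≤ r 0 * d := by
  rw [← finrank_truncObsSpace (A := A) (hr := hr)]
  exact LinearMap.finrank_le_finrank_of_injective
    (f := ((centralizerAction A r hr).act P.1 : centralizer A →ₗ[ℝ] truncObsSpace A r hr))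
    (centralizerAction_injective P)

end

end TruncObs

theorem corollary4p4 {d : ℕ} [NeZero d] (A : Matrix (Fin d) (Fin d) ℝ) (r : Fin d → ℕ)
    (hr : Antitone r) (hn : d ≤ ∑ i, r i) :
    (∀ (X : TruncObs.invCentralizer A) (P : TruncObs.truncObs A r hr),
      TruncObs.rightMul P X = P → X = 1) ∧
    ProperSMul (TruncObs.invCentralizer A)ᵐᵒᵖ (TruncObs.truncObs A r hr) ∧
    T2Space (TruncObs.OrbitSpace A r hr) ∧
    SecondCountableTopology (TruncObs.OrbitSpace A r hr) ∧
    ∃ m : ℕ,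
      (Nonempty (TruncObs.truncObs A r hr) →
        (m : ℤ) = (r 0 : ℤ) * d - TruncObs.dimInvCentralizer A) ∧
      ∃ _ : ChartedSpace (EuclideanSpace ℝ (Fin m)) (TruncObs.OrbitSpace A r hr),
        IsManifold (𝓡 m) ∞ (TruncObs.OrbitSpace A r hr) ∧
        Manifold.IsSubmersion 𝓘(ℝ, TruncObs.truncObsSpace A r hr) (𝓡 m) ∞
          (TruncObs.orbitProj A r hr) := by
  -- For nonempty `𝒫` the injection `X ↦ P X` makes the natural-number subtraction exact. For empty
  -- `𝒫` the value of `m` is immaterial.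
  have hm : Nonempty (TruncObs.truncObs A r hr) →
      (r 0 * d - TruncObs.dimInvCentralizer A) + TruncObs.dimInvCentralizer A = r 0 * d :=
    fun ⟨P⟩ => Nat.sub_add_cancel (TruncObs.dimInvCentralizer_le P)
  refine ⟨TruncObs.eq_one_of_rightMul_eq, TruncObs.properSMul, inferInstance,
    ContinuousConstSMul.secondCountableTopology, r 0 * d - TruncObs.dimInvCentralizer A,
    fun h => ?_, TruncObs.exists_isManifold_orbitSpace hm⟩
  have := hm h
  omega
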